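/- **Setting.** Let $\mathcal S,\mathcal A$ be state and action spaces with reference measures $ds,da$. Let $p(\cdot\mid s,a)$ be a transition kernel and $\bar\pi(a\mid s)$ a known behavior policy (a density with respect to $da$). Let $\xi$ be a stationary state distribution of the chain run under $\bar\pi$, and let $\eta$ be a probability measure on $\mathcal A$ with positive density $\eta(a)$. Let $\mathcal H_S,\mathcal H_A$ be reproducing kernel Hilbert spaces of functions of states and of actions, with finite bases $\phi=(\phi_1,\dots,\phi_{d_S})$ and $\psi=(\psi_1,\dots,\psi_{d_A})$. Assume: 1. *(Low Tucker rank.)* The transition operator $(\mathbb Pf)(s,a)=\int p(s'\mid s,a)f(s')\,ds'$ is of the form $(\mathbb Pf)(s,a)=\sum_{i\le r}\sum_{j\le l}\sum_{k\le m}c_{ijk}\,u_i(s)\,v_j(a)\,\langle f,w_k\rangle_{\mathcal H_S}$ with $u_i,w_k\in\mathcal H_S$, $v_j\in\mathcal H_A$, for all $f\in\mathcal H_S$. 2. *(Data.)* The data are the transitions $(s_t,a_t,s_{t+1})$, $0\le t<n$, of a single sample path generated by $\bar\pi$ (with an arbitrary initial state distribution). 3. *(Blocks.)* There are partitions $\{A_i\}_{i=1}^{n_s}$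 of $\mathcal S$ and $\{B_j\}_{j=1}^{n_a}$ of $\mathcal A$ with $(\xi\times\eta)(A_i\times B_j)>0$ and $p(\cdot\mid s,a)=\sum_{i,j}q^*_{ij}(\cdot)\mathbf 1_{s\in A_i}\mathbf 1_{a\in B_j}$ for probability densities $q^*_{ij}$. **Estimated clusters.** Put $$\bar{\mathbf F}=\frac1n\sum_{t<n}\frac{\eta(a_t)}{\bar\pi(a_t\mid s_t)}\,\phi(s_t)\circ\psi(a_t)\circ\phi(s_{t+1}),\qquad \hat{\mathbf\Sigma}=\frac1n\sum_{t<n}\phi(s_t)\phi(s_t)^\top .$$ Let $\hat{\mathbf F}$ be a minimizer of the tensor spectral norm $\|\mathbf Q-\bar{\mathbf F}\|_\sigma$ over tensors $\mathbf Q$ of Tucker rank at most $(r,l,m)$, and $\hat{\mathbf P}=\hat{\mathbf F}\times_1\hat{\mathbf\Sigma}^{-1}$. Let $\hat{\mathbf U}_1,\hat{\mathbf U}_2,\hat{\mathbf U}_3$ (with $r,l,m$ orthonormal columns) be the left factors of singular value decompositions of the successive unfoldings: of the mode-1 unfolding of $\hat{\mathbf P}$, of the mode-2 unfolding of $\hat{\mathbf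 P}\times_1\hat{\mathbf U}_1^\top$, and of the mode-3 unfolding of $\hat{\mathbf P}\times_1\hat{\mathbf U}_1^\top\times_2\hat{\mathbf U}_2^\top$. Put $\hat{\mathbf C}=\hat{\mathbf P}\times_1\hat{\mathbf U}_1^\top\times_2\hat{\mathbf U}_2^\top\times_3\hat{\mathbf U}_3^\top$, $\hat f=\hat{\mathbf U}_1^\top\phi$, $\hat g=\hat{\mathbf U}_2^\top\psi$. The estimated clusters $\{\hat A_i\}_{i=1}^{n_s},\{\hat B_j\}_{j=1}^{n_a}$ are partitions of $\mathcal S$ and $\mathcal A$ that solve the two $k$-means problems $\min\sum_i\int_{A'_i}\|\hat f-f_i\|^2d\xi$ and $\min\sum_j\int_{B'_j}\|\hat g-g_j\|^2d\eta$ (minimizing over partitions and centers), or that solve the joint problem $\min\sum_{i,j}\int_{A'_i\times B'_j}\|\hat{\mathbf C}\times_1\hat f(s)^\top\times_2\hat g(a)^\top-z_{ij}\|^2d(\xi\times\eta)$. **Errors.** The misclassification error is $$M(\{\hat A_i\},\{\hat B_j\})=\min_{\sigma_1,\sigma_2}\sum_{i=1}^{n_s}\sum_{j=1}^{n_a}\frac{(\xi\times\eta)\big((A_i\times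 B_j)\setminus(\hat A_{\sigma_1(i)}\times\hat B_{\sigma_2(j)})\big)}{(\xi\times\eta)(A_i\times B_j)},$$ the minimum being over permutations $\sigma_1$ of $[n_s]$ and $\sigma_2$ of $[n_a]$. The $H$-step state abstraction error is $$D(\{\hat A_i\},\{\hat B_j\})=\sup\ \inf_{\hat p}\ \Big|\mathbb E^\pi_{p'}\Big[\sum_{h=1}^Hr_h(S_h,A_h)\Big]-\mathbb E^\pi_{\hat p}\Big[\sum_{h=1}^Hr_h(S_h,A_h)\Big]\Big|.$$ Here the supremum is over all block-structured instances on $\{A_i\},\{B_j\}$: transition kernels $p'$ of the form in assumption 3 with arbitrary densities; rewards $r_h$ with values in $[0,1]$ that depend on $(s,a)$ only through the blocks; policies $\pi$ with $\pi(\cdot\mid s)$ depending on $s$ only through its block (the choice of an action within an action block being unrestricted); and initial distributions whose density with respect to $\xi$ is constant on each $A_i$, used in both expectations. The infimum is over the transition kernels on the estimated clusters whose density with respect to $\xi$ is $$\hat p(s'\mid s,a)=\sum_{i,k=1}^{n_s}\sum_{j=1}^{n_a}\frac{\hat q(k\mid i,j)}{\xi(\hat A_k)}\mathbf 1_{s\in\hat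 A_i}\mathbf 1_{a\in\hat B_j}\mathbf 1_{s'\in\hat A_k},$$ with $\hat q(\cdot\mid i,j)$ discrete probability distributions. **Theorem.** Let $\delta\in(0,1)$, $\underline c=\min_{i,j}(\xi\times\eta)(A_i\times B_j)$ and $\bar c=\max_{i,j}(\xi\times\eta)(A_i\times B_j)$. For all sufficiently large $n$, with probability at least $1-\delta$, the estimated clusters satisfy, for every horizon $H$, $$D(\{\hat A_i\},\{\hat B_j\})\le 4\,\bar c\,\underline c^{-1}H^2\,M(\{\hat A_i\},\{\hat B_j\}).$$ -/

import Mathlib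

open MeasureTheory ProbabilityTheory
open scoped NNReal ENNReal ProbabilityTheory

noncomputable section

namespace TensorMDP

/-! ### Third-order tensors -/

/-- Real tensors of size `a × b × c`. -/
abbrev Tensor3 (a b c : ℕ) : Type := Fin a → Fin b → Fin c → ℝ

section Tensors

variable {a b c q : ℕ}

/-- The three matricizations (flattenings) of a tensor. -/
def unfold1 (X : Tensor3 a b c) : Matrix (Fin a) (Fin b × Fin c) ℝ :=
  Matrix.of fun i jk => X i jk.1 jk.2

def unfold2 (X : Tensor3 a b c) : Matrix (Fin b) (Fin a × Fin c) ℝ :=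
  Matrix.of fun j ik => X ik.1 j ik.2

def unfold3 (X : Tensor3 a b c) : Matrix (Fin c) (Fin a × Fin b) ℝ :=
  Matrix.of fun k ij => X ij.1 ij.2 k

/-- The mode products of a tensor with a matrix. -/
def modeMul1 (X : Tensor3 a b c) (U : Matrix (Fin q) (Fin a) ℝ) : Tensor3 q b c :=
  fun i j k => ∑ t, X t j k * U i t

def modeMul2 (X : Tensor3 a b c) (U : Matrix (Fin q) (Fin b) ℝ) : Tensor3 a q c :=
  fun i j k => ∑ t, X i t k * U j t

def modeMul3 (X : Tensor3 a b c) (U : Matrix (Fin q) (Fin c) ℝ) : Tensor3 a b q :=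
  fun i j k => ∑ t, X i j t * U k t

/-- `Tucker-Rank(X) ≤ (r, l, m)`. -/
def TuckerRankLE (X : Tensor3 a b c) (r l m : ℕ) : Prop :=
  (unfold1 X).rank ≤ r ∧ (unfold2 X).rank ≤ l ∧ (unfold3 X).rank ≤ m

/-- The tensor spectral norm: the supremum of `⟨X, u ∘ v ∘ w⟩` over Euclidean unit vectors. -/
def specNorm (X : Tensor3 a b c) : ℝ :=
  sSup {t : ℝ | ∃ (u : EuclideanSpace ℝ (Fin a)) (v : EuclideanSpace ℝ (Fin b))
    (w : EuclideanSpace ℝ (Fin c)), ‖u‖ = 1 ∧ ‖v‖ = 1 ∧ ‖w‖ = 1 ∧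
      t = ∑ i, ∑ j, ∑ k, X i j k * (u i * v j * w k)}

/-- `Q` is a best approximation of `X` in spectral norm among the tensors of Tucker rank at most
`(r, l, m)`. -/
def IsBestLowRank (r l m : ℕ) (X Q : Tensor3 a b c) : Prop :=
  TuckerRankLE Q r l m ∧
    ∀ Q' : Tensor3 a b c, TuckerRankLE Q' r l m →
      specNorm (fun i j k => Q i j k - X i j k) ≤ specNorm (fun i j k => Q' i j k - X i j k)

end Tensors

/-- `U` is the left factor of a singular value decomposition `X = U Λ Vᵀ` with `r` columns:
`U` has orthonormal columns, `Λ` is diagonal with nonnegative nonincreasing entries, and the right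
singular vectors that belong to the positive singular values are orthonormal (the remaining ones
play no role). -/
def IsLeftSVD {a r : ℕ} {ι : Type*} [Fintype ι] (X : Matrix (Fin a) ι ℝ)
    (U : Matrix (Fin a) (Fin r) ℝ) : Prop :=
  U.transpose * U = 1 ∧
    ∃ (sv : Fin r → ℝ) (V : Matrix ι (Fin r) ℝ),
      Antitone sv ∧ (∀ i, 0 ≤ sv i) ∧
      (∀ i j, sv i ≠ 0 → sv j ≠ 0 → (V.transpose * V) i j = if i = j then 1 else 0) ∧
      X = U * Matrix.diagonal sv * V.transpose

/-! ### Partitions and clustering -/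

/-- A partition of a measurable space into `k` labelled measurable (possibly empty) sets. -/
structure IsMeasPartition {X : Type*} [MeasurableSpace X] {k : ℕ} (C : Fin k → Set X) : Prop where
  measurable : ∀ i, MeasurableSet (C i)
  disjoint : Pairwise fun i j => Disjoint (C i) (C j)
  cover : (⋃ i, C i) = Set.univ

/-- The objective `∑ i, ∫_{C i} ‖f - z i‖² dμ` of `k`-means. -/
def kmeansCost {X : Type*} [MeasurableSpace X] {k d : ℕ} (μ : Measure X) (f : X → Fin d → ℝ)
    (C : Fin k → Set X) (z : Fin k → Fin d → ℝ) : ℝ≥0∞ :=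
  ∑ i, ∫⁻ x in C i, ENNReal.ofReal (∑ t, (f x t - z i t) ^ 2) ∂μ

/-- `C` is an optimal partition for `k`-means with respect to `μ` and the map `f`. -/
def IsKMeans {X : Type*} [MeasurableSpace X] {k d : ℕ} (μ : Measure X) (f : X → Fin d → ℝ)
    (C : Fin k → Set X) : Prop :=
  IsMeasPartition C ∧
    ∃ z : Fin k → Fin d → ℝ, ∀ (C' : Fin k → Set X) (z' : Fin k → Fin d → ℝ),
      IsMeasPartition C' → kmeansCost μ f C z ≤ kmeansCost μ f C' z'

section MDP

variable {S A : Type*} [MeasurableSpace S] [MeasurableSpace A]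

/-- The objective `∑ i j, ∫_{C i × E j} ‖Φ(s,a) - z i j‖² d(ξ × η)` of the joint state-action
clustering problem. -/
def jointCost {ns na d : ℕ} (ξ : Measure S) (η : Measure A) (Φ : S → A → Fin d → ℝ)
    (C : Fin ns → Set S) (E : Fin na → Set A) (z : Fin ns → Fin na → Fin d → ℝ) : ℝ≥0∞ :=
  ∑ i, ∑ j, ∫⁻ x in C i ×ˢ E j, ENNReal.ofReal (∑ t, (Φ x.1 x.2 t - z i j t) ^ 2) ∂(ξ.prod η)

/-- `(C, E)` solves the joint state-action clustering problem. -/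
def IsJointClustering {ns na d : ℕ} (ξ : Measure S) (η : Measure A) (Φ : S → A → Fin d → ℝ)
    (C : Fin ns → Set S) (E : Fin na → Set A) : Prop :=
  IsMeasPartition C ∧ IsMeasPartition E ∧
    ∃ z : Fin ns → Fin na → Fin d → ℝ,
      ∀ (C' : Fin ns → Set S) (E' : Fin na → Set A) (z' : Fin ns → Fin na → Fin d → ℝ),
        IsMeasPartition C' → IsMeasPartition E' →
          jointCost ξ η Φ C E z ≤ jointCost ξ η Φ C' E' z'

/-! ### Markov decision processes -/

/-- The state transition kernel `p^π(·|s) = ∫ π(da|s) p(·|s,a)`. -/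
def stateKernel (p : Kernel (S × A) S) (π : Kernel S A) : Kernel S S :=
  p ∘ₖ (Kernel.id ×ₖ π)

/-- One step of the state-action chain: from `(s,a)` draw `s' ∼ p(·|s,a)`, then `a' ∼ π(·|s')`. -/
def stateActionKernel (p : Kernel (S × A) S) (π : Kernel S A) : Kernel (S × A) (S × A) :=
  (Kernel.id ×ₖ π) ∘ₖ p

instance (p : Kernel (S × A) S) (π : Kernel S A) [IsMarkovKernel p] [IsMarkovKernel π] :
    IsMarkovKernel (stateActionKernel p π) := by
  unfold stateActionKernel; infer_instance

/-- The law of the trajectory `(s_0, a_0), (s_1, a_1), …` with `s_0 ∼ μ`, transition kernel `p` and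
policy `π`. -/
def pathLaw (μ : Measure S) [IsProbabilityMeasure μ] (p : Kernel (S × A) S) [IsMarkovKernel p]
    (π : Kernel S A) [IsMarkovKernel π] : Measure (ℕ → S × A) :=
  Kernel.trajMeasure (X := fun _ => S × A) (μ ⊗ₘ π) fun n =>
    (stateActionKernel p π).comap
      (fun h : ((i : Finset.Iic n) → S × A) => h ⟨n, Finset.mem_Iic.2 le_rfl⟩)
      (measurable_pi_apply _)

/-- The expected return over `H` steps. -/
def expectedReturn (μ : Measure S) [IsProbabilityMeasure μ] (p : Kernel (S × A) S)
    [IsMarkovKernel p] (π : Kernel S A) [IsMarkovKernel π] (r : ℕ → S × A → ℝ) (H : ℕ) : ℝ :=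
  ∫ x, ∑ h ∈ Finset.range H, r h (x h) ∂(pathLaw μ p π)

/-- The transition kernel has densities (with respect to the reference measure `vS`) of the form
`p(s'|s,a) = ∑ i j, q i j (s') 1_{s ∈ C i} 1_{a ∈ E j}` with probability densities `q i j`. -/
def IsBlockTransition {ns na : ℕ} (vS : Measure S) (C : Fin ns → Set S) (E : Fin na → Set A)
    (p : Kernel (S × A) S) : Prop :=
  ∃ q : Fin ns → Fin na → S → ℝ≥0,
    (∀ i j, Measurable (q i j)) ∧ (∀ i j, ∫⁻ s, (q i j s : ℝ≥0∞) ∂vS = 1) ∧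
    ∀ s a, p (s, a) = vS.withDensity fun s' =>
      ∑ i, ∑ j, (q i j s' : ℝ≥0∞) * (C i).indicator 1 s * (E j).indicator 1 a

/-- The reward `r_h(s,a) ∈ [0,1]` depends on `(s,a)` only through the blocks. -/
structure IsBlockReward {ns na : ℕ} (C : Fin ns → Set S) (E : Fin na → Set A)
    (r : ℕ → S × A → ℝ) : Prop where
  mem_Icc : ∀ h x, r h x ∈ Set.Icc (0 : ℝ) 1
  block : ∀ h i j, ∀ s ∈ C i, ∀ s' ∈ C i, ∀ a ∈ E j, ∀ a' ∈ E j, r h (s, a) = r h (s', a')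

/-- The policy treats all states of a block alike. How it selects an action inside an action block
is left free, so that this contains all policies given by probabilities `π(j|i)` of action blocks
together with any fixed rule for choosing the action in a block. -/
def IsBlockPolicy {ns : ℕ} (C : Fin ns → Set S) (π : Kernel S A) : Prop :=
  ∀ i, ∀ s ∈ C i, ∀ s' ∈ C i, π s = π s'

/-- The initial distribution is block-structured: its density with respect to `ξ` is constant on
every block. -/
def IsBlockInitial {ns : ℕ} (ξ : Measure S) (C : Fin ns → Set S) (μ : Measure S) : Prop :=
  ∃ w : Fin ns → ℝ≥0, μ = ξ.withDensity fun s => ∑ i, (w i : ℝ≥0∞) * (C i).indicator 1 s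

/-- Transition models on the clusters `(C, E)`: the density with respect to `ξ` is
`p̂(s'|s,a) = ∑ i j k, q̂(k|i,j) / ξ(C k) 1_{s ∈ C i} 1_{a ∈ E j} 1_{s' ∈ C k}` with discrete transition
probabilities `q̂(k|i,j) = q i j k`. -/
def IsClusterTransition {ns na : ℕ} (ξ : Measure S) (C : Fin ns → Set S) (E : Fin na → Set A)
    (p : Kernel (S × A) S) : Prop :=
  ∃ q : Fin ns → Fin na → Fin ns → ℝ≥0,
    (∀ i j, ∑ k, q i j k = 1) ∧
    ∀ s a, p (s, a) = ξ.withDensity fun s' =>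
      ∑ i, ∑ j, ∑ k, (q i j k : ℝ≥0∞) / ξ (C k) *
        (C i).indicator 1 s * (E j).indicator 1 a * (C k).indicator 1 s'

/-- The `H`-step state abstraction error of the clusters `(C', E')`: the supremum over all
block-structured instances (initial distribution, transition kernel, rewards) and policies on the
true blocks `(C, E)` of the policy evaluation error of a best-fit transition model on the
clusters. -/
def abstractionError {ns na : ℕ} (vS ξ : Measure S) (C : Fin ns → Set S) (E : Fin na → Set A)
    (C' : Fin ns → Set S) (E' : Fin na → Set A) (H : ℕ) : ℝ≥0∞ :=
  ⨆ (μ : Measure S) (_ : IsProbabilityMeasure μ) (_ : IsBlockInitial ξ C μ)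
    (p : Kernel (S × A) S) (_ : IsMarkovKernel p) (_ : IsBlockTransition vS C E p)
    (r : ℕ → S × A → ℝ) (_ : IsBlockReward C E r)
    (π : Kernel S A) (_ : IsMarkovKernel π) (_ : IsBlockPolicy C π),
  ⨅ (p' : Kernel (S × A) S) (_ : IsMarkovKernel p') (_ : IsClusterTransition ξ C' E' p'),
    ENNReal.ofReal |expectedReturn μ p π r H - expectedReturn μ p' π r H|

/-- The misclassification error of the clusters `(C', E')` for the true blocks `(C, E)`. -/
def misclassification {ns na : ℕ} (ξ : Measure S) (η : Measure A) (C : Fin ns → Set S)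
    (E : Fin na → Set A) (C' : Fin ns → Set S) (E' : Fin na → Set A) : ℝ≥0∞ :=
  ⨅ (σ₁ : Equiv.Perm (Fin ns)) (σ₂ : Equiv.Perm (Fin na)),
    ∑ i, ∑ j, (ξ.prod η) ((C i ×ˢ E j) \ (C' (σ₁ i) ×ˢ E' (σ₂ j))) / (ξ.prod η) (C i ×ˢ E j)

/-- The largest and the smallest mass of a product of blocks. -/
def maxMass {ns na : ℕ} (ξ : Measure S) (η : Measure A) (C : Fin ns → Set S)
    (E : Fin na → Set A) : ℝ≥0∞ :=
  ⨆ (i : Fin ns) (j : Fin na), (ξ.prod η) (C i ×ˢ E j)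

def minMass {ns na : ℕ} (ξ : Measure S) (η : Measure A) (C : Fin ns → Set S)
    (E : Fin na → Set A) : ℝ≥0∞ :=
  ⨅ (i : Fin ns) (j : Fin na), (ξ.prod η) (C i ×ˢ E j)

/-- The transition operator `f ↦ ∫ f(s') p(ds'|s,a)` on the RKHS `HS` is defined and has Tucker rank
at most `(r, l, m)`, that is, it is of the form
`(s,a) ↦ ∑ i j k, c i j k u i (s) v j (a) ⟨f, w k⟩` with `u i, w k ∈ HS` and `v j ∈ HA`; in particular
it maps `HS` into the tensor product of `HS` and `HA`. -/
def OperatorTuckerRankLE (HS HA : Type*) [NormedAddCommGroup HS] [InnerProductSpace ℝ HS]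
    [RKHS ℝ HS S ℝ] [NormedAddCommGroup HA] [InnerProductSpace ℝ HA] [RKHS ℝ HA A ℝ]
    (p : Kernel (S × A) S) (r l m : ℕ) : Prop :=
  (∀ (f : HS) (x : S × A), Integrable (fun s' => f s') (p x)) ∧
    ∃ (c : Fin r → Fin l → Fin m → ℝ) (u : Fin r → HS) (v : Fin l → HA) (w : Fin m → HS),
      ∀ (f : HS) (s : S) (a : A), ∫ s', f s' ∂(p (s, a)) =
        ∑ i, ∑ j, ∑ k, c i j k * u i s * v j a * inner ℝ f (w k)

/-! ### The estimation procedure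

The data are the first `n` transitions `(s_t, a_t, s_{t+1})`, `t < n`, of a path `x`. -/

variable {dS dA : ℕ}

/-- The importance sampling estimator
`F̄ = n⁻¹ ∑ t, η(a_t) / π̄(a_t|s_t) φ(s_t) ∘ ψ(a_t) ∘ φ(s_{t+1})`. -/
def Fbar (φ : S → Fin dS → ℝ) (ψ : A → Fin dA → ℝ) (ηd : A → ℝ≥0) (πd : S → A → ℝ≥0)
    (n : ℕ) (x : ℕ → S × A) : Tensor3 dS dA dS :=
  fun i j k => (n : ℝ)⁻¹ * ∑ t ∈ Finset.range n,
    ((ηd (x t).2 : ℝ) / (πd (x t).1 (x t).2 : ℝ)) *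
      (φ (x t).1 i * ψ (x t).2 j * φ (x (t + 1)).1 k)

/-- The empirical second moment matrix `Σ̂ = n⁻¹ ∑ t, φ(s_t) φ(s_t)ᵀ`. -/
def SigmaHat (φ : S → Fin dS → ℝ) (n : ℕ) (x : ℕ → S × A) : Matrix (Fin dS) (Fin dS) ℝ :=
  Matrix.of fun i j => (n : ℝ)⁻¹ * ∑ t ∈ Finset.range n, φ (x t).1 i * φ (x t).1 j

/-- The joint embedding `Φ̂(s,a) = G ×₁ f(s)ᵀ ×₂ g(a)ᵀ`. -/
def jointEmbedding {r l m : ℕ} (G : Tensor3 r l m) (f : S → Fin r → ℝ) (g : A → Fin l → ℝ) :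
    S → A → Fin m → ℝ :=
  fun s a k => ∑ i, ∑ j, G i j k * f s i * g a j

/-- `(C', E')` are estimated state and action clusters computed from the first `n` transitions of the
path `x`: `F` is a best low-rank approximation of `F̄`, `P̂ = F ×₁ Σ̂⁻¹`, the factors `U₁, U₂, U₃` come
from successive singular value decompositions, giving the embeddings `f = U₁ᵀ φ`, `g = U₂ᵀ ψ` and
the core tensor `G`; the clusters are obtained either by applying `k`-means separately to `f` and `g`
or by solving the joint clustering problem for the joint embedding. -/
def IsEstimatedClusters {ns na : ℕ} (φ : S → Fin dS → ℝ) (ψ : A → Fin dA → ℝ)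
    (ηd : A → ℝ≥0) (πd : S → A → ℝ≥0) (ξ : Measure S) (η : Measure A) (r l m n : ℕ)
    (x : ℕ → S × A) (C' : Fin ns → Set S) (E' : Fin na → Set A) : Prop :=
  ∃ (F : Tensor3 dS dA dS) (U₁ : Matrix (Fin dS) (Fin r) ℝ) (U₂ : Matrix (Fin dA) (Fin l) ℝ)
    (U₃ : Matrix (Fin dS) (Fin m) ℝ),
    IsBestLowRank r l m (Fbar φ ψ ηd πd n x) F ∧
    let P₁ : Tensor3 dS dA dS := modeMul1 F (SigmaHat φ n x)⁻¹
    let P₂ : Tensor3 r dA dS := modeMul1 P₁ U₁.transpose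
    let P₃ : Tensor3 r l dS := modeMul2 P₂ U₂.transpose
    let G : Tensor3 r l m := modeMul3 P₃ U₃.transpose
    let f : S → Fin r → ℝ := fun s => U₁.transpose.mulVec (φ s)
    let g : A → Fin l → ℝ := fun a => U₂.transpose.mulVec (ψ a)
    IsLeftSVD (unfold1 P₁) U₁ ∧ IsLeftSVD (unfold2 P₂) U₂ ∧ IsLeftSVD (unfold3 P₃) U₃ ∧
    ((IsKMeans ξ f C' ∧ IsKMeans η g E') ∨ IsJointClustering ξ η (jointEmbedding G f g) C' E')

end MDP

end TensorMDP

end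

/-! The inequality is deterministic: it holds for any two measurable partitions, so the good event
is the whole path space and the estimation procedure matters only through its output being
partitions (`abstractionError_le`).

The infimum over cluster models is taken after the instance is fixed, so the model may depend on the
policy `π`. It can therefore ignore the action and copy the block chain `T i k = p^π(C k | C i)`,
landing in cluster `k` with law `ξ[|D k]`, where `D` is the suitably relabelled family of state
clusters. Action clusters then play no role, and only the state part `ε = ∑ ξ(C i \ D i) / ξ(C i)`
of the misclassification matters.

Under the true model the block masses evolve by `T`; under the copied model the cluster masses
evolve by the same `T`. Their initial `ℓ¹` distance is at most `2ε`, since the initial law is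
proportional to `ξ` on each block, and a stochastic matrix cannot increase it. Passing from cluster
masses to block masses under the copied model multiplies by the matrix `ξ(C i | D k)`, whose
diagonal is within `2Kε` of one, with `K` bounding the ratios of block masses; this costs `4Kε`
more. Expected rewards depend only on block masses and lie in `[0,1]`, so each step loses at most
half of the total, `ε + 2Kε ≤ 3Kε`, and the return at most `3KεH`
(`exists_isClusterTransition_expectedReturn_le`).

This needs `ε ≤ 1/2`, so that clusters retain half of their blocks. If the misclassification error
exceeds `1/2`, the trivial bound `H` on the difference of returns suffices. -/

namespace TensorMDP

/-! ### Measurable partitions -/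

namespace IsMeasPartition

variable {X : Type*} [MeasurableSpace X] {k : ℕ} {C D : Fin k → Set X}

theorem exists_mem (hC : IsMeasPartition C) (x : X) : ∃ i, x ∈ C i := by
  have : x ∈ ⋃ i, C i := by rw [hC.cover]; trivial
  simpa using this

/-- The label of the block that contains a point. -/
noncomputable def label (hC : IsMeasPartition C) (x : X) : Fin k := (hC.exists_mem x).choose

theorem mem_label (hC : IsMeasPartition C) (x : X) : x ∈ C (hC.label x) :=
  (hC.exists_mem x).choose_spec

theorem eq_of_mem (hC : IsMeasPartition C) {x : X} {i j : Fin k} (hi : x ∈ C i) (hj : x ∈ C j) :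
    i = j := by
  by_contra h
  exact Set.disjoint_left.1 (hC.disjoint h) hi hj

theorem label_eq_iff (hC : IsMeasPartition C) {x : X} {i : Fin k} :
    hC.label x = i ↔ x ∈ C i :=
  ⟨fun h => h ▸ hC.mem_label x, fun h => hC.eq_of_mem (hC.mem_label x) h⟩

theorem label_preimage (hC : IsMeasPartition C) (i : Fin k) : hC.label ⁻¹' {i} = C i := by
  ext x
  simp [hC.label_eq_iff]

theorem measurable_label (hC : IsMeasPartition C) : Measurable hC.label :=
  measurable_to_countable' fun i => by
    rw [hC.label_preimage]
    exact hC.measurable i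

theorem comp_equiv (hC : IsMeasPartition C) (σ : Equiv.Perm (Fin k)) :
    IsMeasPartition fun i => C (σ i) where
  measurable i := hC.measurable _
  disjoint _ _ h := hC.disjoint (σ.injective.ne h)
  cover := by rw [σ.surjective.iUnion_comp C, hC.cover]

theorem integral_label (hC : IsMeasPartition C) (μ : Measure X) [IsFiniteMeasure μ]
    (f : Fin k → ℝ) : ∫ x, f (hC.label x) ∂μ = ∑ i, μ.real (C i) * f i := by
  have : IsFiniteMeasure (μ.map hC.label) := inferInstance
  rw [← integral_map (φ := hC.label) (f := f) hC.measurable_label.aemeasurable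
    (measurable_of_finite f).aestronglyMeasurable, integral_fintype (Integrable.of_finite)]
  refine Finset.sum_congr rfl fun i _ => ?_
  rw [map_measureReal_apply hC.measurable_label (measurableSet_singleton i), hC.label_preimage,
    smul_eq_mul]

theorem lintegral_label (hC : IsMeasPartition C) (μ : Measure X) (f : Fin k → ℝ≥0∞) :
    ∫⁻ x, f (hC.label x) ∂μ = ∑ i, μ (C i) * f i := by
  rw [← lintegral_map (g := hC.label) (f := f) (measurable_of_finite f) hC.measurable_label,
    lintegral_fintype]
  refine Finset.sum_congr rfl fun i _ => ?_
  rw [Measure.map_apply hC.measurable_label (measurableSet_singleton i), hC.label_preimage,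
    mul_comm]

theorem sum_measureReal_inter (hC : IsMeasPartition C) (μ : Measure X) [IsFiniteMeasure μ]
    (B : Set X) : ∑ i, μ.real (B ∩ C i) = μ.real B := by
  have h := hC.integral_label (μ.restrict B) (fun _ => 1)
  simp only [integral_const, smul_eq_mul, mul_one, measureReal_restrict_apply MeasurableSet.univ,
    Set.univ_inter] at h
  rw [h]
  exact Finset.sum_congr rfl fun i _ => by
    rw [measureReal_restrict_apply (hC.measurable i), Set.inter_comm]

theorem sum_measureReal (hC : IsMeasPartition C) (μ : Measure X) [IsProbabilityMeasure μ] :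
    ∑ i, μ.real (C i) = 1 := by
  have h := hC.sum_measureReal_inter μ Set.univ
  simpa using h

/-- Lumpability: when a kernel sees only the block of its argument, block masses determine the law
after one step. This reduces both state processes to finite chains. -/
theorem comp_apply_of_eqOn (hC : IsMeasPartition C) (μ : Measure X) [IsFiniteMeasure μ]
    {Y : Type*} [MeasurableSpace Y] (K : Kernel X Y) [IsMarkovKernel K] (κ : Fin k → Measure Y)
    [∀ i, IsFiniteMeasure (κ i)]
    (hK : ∀ i, ∀ x ∈ C i, K x = κ i) {B : Set Y} (hB : MeasurableSet B) :
    (K ∘ₘ μ).real B = ∑ i, μ.real (C i) * (κ i).real B := by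
  have h : (K ∘ₘ μ) B = ∑ i, μ (C i) * κ i B := by
    rw [Measure.bind_apply hB K.aemeasurable, ← hC.lintegral_label μ fun i => κ i B]
    exact lintegral_congr fun x => by rw [hK _ x (hC.mem_label x)]
  rw [measureReal_def, h, ENNReal.toReal_sum fun i _ =>
    ENNReal.mul_ne_top (measure_ne_top _ _) (measure_ne_top _ _)]
  exact Finset.sum_congr rfl fun i _ => ENNReal.toReal_mul

/-- Removing the common parts `C i ∩ D i` from either partition leaves the same mass, as both have
total mass one. -/
theorem sum_measureReal_diff_comm (hC : IsMeasPartition C) (hD : IsMeasPartition D)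
    (μ : Measure X) [IsProbabilityMeasure μ] :
    ∑ i, μ.real (D i \ C i) = ∑ i, μ.real (C i \ D i) := by
  have h₁ : ∀ i, μ.real (D i \ C i) = μ.real (D i) - μ.real (C i ∩ D i) := fun i => by
    rw [← measureReal_inter_add_sdiff (s := D i) (hC.measurable i), Set.inter_comm]; ring
  have h₂ : ∀ i, μ.real (C i \ D i) = μ.real (C i) - μ.real (C i ∩ D i) := fun i => by
    rw [← measureReal_inter_add_sdiff (s := C i) (hD.measurable i)]; ring
  simp only [h₁, h₂, Finset.sum_sub_distrib, hC.sum_measureReal, hD.sum_measureReal]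

/-- The vectors of block masses of two labelled partitions differ in `ℓ¹` by at most twice the
mass of the points with different labels. -/
theorem sum_abs_measureReal_sub_le (hC : IsMeasPartition C) (hD : IsMeasPartition D)
    (μ : Measure X) [IsProbabilityMeasure μ] :
    ∑ i, |μ.real (C i) - μ.real (D i)| ≤ 2 * ∑ i, μ.real (C i \ D i) := by
  have h : ∀ i, |μ.real (C i) - μ.real (D i)| ≤ μ.real (C i \ D i) + μ.real (D i \ C i) := by
    intro i
    have h₁ := measureReal_inter_add_sdiff (μ := μ) (s := D i) (hC.measurable i)
    have h₂ := measureReal_inter_add_sdiff (μ := μ) (s := C i) (hD.measurable i)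
    rw [Set.inter_comm] at h₁
    have h₃ : 0 ≤ μ.real (C i \ D i) := measureReal_nonneg
    have h₄ : 0 ≤ μ.real (D i \ C i) := measureReal_nonneg
    rw [abs_le]
    constructor <;> linarith
  calc _ ≤ ∑ i, (μ.real (C i \ D i) + μ.real (D i \ C i)) := Finset.sum_le_sum fun i _ => h i
    _ = _ := by rw [Finset.sum_add_distrib, hC.sum_measureReal_diff_comm hD]; ring

end IsMeasPartition

/-! ### Finite Markov chains -/

section Chains

variable {k : ℕ}

theorem sum_abs_vecMul_le (T : Fin k → Fin k → ℝ) (hT : ∀ i j, 0 ≤ T i j)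
    (hT1 : ∀ i, ∑ j, T i j = 1) (d : Fin k → ℝ) :
    ∑ j, |∑ i, d i * T i j| ≤ ∑ i, |d i| := by
  calc ∑ j, |∑ i, d i * T i j| ≤ ∑ j, ∑ i, |d i| * T i j :=
        Finset.sum_le_sum fun j _ => (Finset.abs_sum_le_sum_abs _ _).trans_eq <|
          Finset.sum_congr rfl fun i _ => by rw [abs_mul, abs_of_nonneg (hT i j)]
    _ = ∑ i, |d i| := by
        rw [Finset.sum_comm]
        exact Finset.sum_congr rfl fun i _ => by rw [← Finset.mul_sum, hT1, mul_one]

/-- Two copies of a finite Markov chain do not move apart in `ℓ¹`. -/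
theorem sum_abs_sub_le_of_step (T : Fin k → Fin k → ℝ) (hT : ∀ i j, 0 ≤ T i j)
    (hT1 : ∀ i, ∑ j, T i j = 1) (a b : ℕ → Fin k → ℝ)
    (ha : ∀ n j, a (n + 1) j = ∑ i, a n i * T i j)
    (hb : ∀ n j, b (n + 1) j = ∑ i, b n i * T i j) (n : ℕ) :
    ∑ i, |a n i - b n i| ≤ ∑ i, |a 0 i - b 0 i| := by
  induction n with
  | zero => exact le_rfl
  | succ n ih =>
    refine le_trans (le_of_eq ?_)
      ((sum_abs_vecMul_le T hT hT1 fun i => a n i - b n i).trans ih)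
    simp only [ha, hb, sub_mul, Finset.sum_sub_distrib]

/-- Applying a nearly diagonal stochastic matrix to a probability vector changes it little. -/
theorem sum_abs_sub_vecMul_le (B : Fin k → Fin k → ℝ) (hB : ∀ i j, 0 ≤ B i j)
    (hB1 : ∀ i, ∑ j, B i j = 1) {β : ℝ} (hβ : ∀ i, 1 - B i i ≤ β) (b : Fin k → ℝ)
    (hb : ∀ i, 0 ≤ b i) (hb1 : ∑ i, b i = 1) :
    ∑ j, |b j - ∑ i, b i * B i j| ≤ 2 * β := by
  have hrow : ∀ i, ∑ j, |(if i = j then 1 else 0) - B i j| ≤ 2 * β := by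
    intro i
    -- Written as `B i j` plus a diagonal correction, the row sums to exactly `2 * (1 - B i i)`.
    have h₁ : ∀ j, |(if i = j then 1 else 0) - B i j| =
        B i j + if i = j then 1 - 2 * B i i else 0 := by
      intro j
      split_ifs with h
      · subst h
        have : B i i ≤ 1 := hB1 i ▸ Finset.single_le_sum (fun j _ => hB i j) (Finset.mem_univ i)
        rw [abs_of_nonneg (by linarith)]; ring
      · rw [zero_sub, abs_neg, abs_of_nonneg (hB i j), add_zero]
    simp only [h₁, Finset.sum_add_distrib, hB1, Finset.sum_ite_eq, Finset.mem_univ, if_true]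
    linarith [hβ i]
  calc ∑ j, |b j - ∑ i, b i * B i j|
      = ∑ j, |∑ i, b i * ((if i = j then 1 else 0) - B i j)| := by
        simp [mul_sub, Finset.sum_sub_distrib]
    _ ≤ ∑ j, ∑ i, b i * |(if i = j then 1 else 0) - B i j| :=
        Finset.sum_le_sum fun j _ => (Finset.abs_sum_le_sum_abs _ _).trans_eq <|
          Finset.sum_congr rfl fun i _ => by rw [abs_mul, abs_of_nonneg (hb i)]
    _ = ∑ i, b i * ∑ j, |(if i = j then 1 else 0) - B i j| := by
        rw [Finset.sum_comm]
        simp only [Finset.mul_sum]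
    _ ≤ ∑ i, b i * (2 * β) := Finset.sum_le_sum fun i _ => mul_le_mul_of_nonneg_left (hrow i) (hb i)
    _ = 2 * β := by rw [← Finset.sum_mul, hb1, one_mul]

/-- The means of a `[0,1]`-valued function under two probability vectors differ by at most half of
their `ℓ¹` distance. -/
theorem abs_sum_mul_sub_le (a b f : Fin k → ℝ) (hab : ∑ i, a i = ∑ i, b i)
    (hf : ∀ i, f i ∈ Set.Icc (0 : ℝ) 1) :
    |∑ i, a i * f i - ∑ i, b i * f i| ≤ 2⁻¹ * ∑ i, |a i - b i| := by
  -- Equal total masses allow centring `f` at `1/2`; this is where the factor `1/2` is gained.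
  have h : ∑ i, a i * f i - ∑ i, b i * f i = ∑ i, (a i - b i) * (f i - 2⁻¹) := by
    simp only [mul_sub, sub_mul, Finset.sum_sub_distrib, ← Finset.sum_mul]
    rw [hab]; ring
  rw [h, Finset.mul_sum]
  refine (Finset.abs_sum_le_sum_abs _ _).trans (Finset.sum_le_sum fun i _ => ?_)
  rw [abs_mul, mul_comm]
  refine mul_le_mul_of_nonneg_right ?_ (abs_nonneg _)
  rw [abs_le]
  constructor <;> linarith [(hf i).1, (hf i).2]

end Chains

variable {S A : Type*} [MeasurableSpace S] [MeasurableSpace A]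

/-! ### Marginals of the trajectory -/

instance (p : Kernel (S × A) S) (π : Kernel S A) [IsMarkovKernel p] [IsMarkovKernel π] :
    IsMarkovKernel (stateKernel p π) := by
  unfold stateKernel; infer_instance

/-- The law of the `n`-th state of the trajectory. -/
noncomputable def stateLaw (μ : Measure S) (p : Kernel (S × A) S) (π : Kernel S A) : ℕ → Measure S
  | 0 => μ
  | n + 1 => stateKernel p π ∘ₘ stateLaw μ p π n

section Path

variable (μ : Measure S) [IsProbabilityMeasure μ] (p : Kernel (S × A) S) [IsMarkovKernel p]
  (π : Kernel S A) [IsMarkovKernel π]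

instance isProbabilityMeasure_stateLaw (n : ℕ) : IsProbabilityMeasure (stateLaw μ p π n) := by
  induction n with
  | zero => simpa [stateLaw]
  | succ n ih => unfold stateLaw; infer_instance

instance : IsProbabilityMeasure (pathLaw μ p π) := by
  unfold pathLaw; infer_instance

theorem pathLaw_map_zero : (pathLaw μ p π).map (fun x => x 0) = μ ⊗ₘ π := by
  set κ : (n : ℕ) → Kernel (Π _ : Finset.Iic n, S × A) (S × A) := fun n =>
    (stateActionKernel p π).comap
      (fun h : ((i : Finset.Iic n) → S × A) => h ⟨n, Finset.mem_Iic.2 le_rfl⟩)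
      (measurable_pi_apply _)
  let e : (Π _ : Finset.Iic 0, S × A) → S × A := fun h => h ⟨0, Finset.mem_Iic.2 le_rfl⟩
  have he : Measurable e := measurable_pi_apply _
  have h : (fun x : ℕ → S × A => x 0) =
      e ∘ Preorder.frestrictLe (π := fun _ => S × A) 0 := rfl
  have h' : pathLaw μ p π = (Kernel.traj (X := fun _ => S × A) κ 0) ∘ₘ
    ((μ ⊗ₘ π).map (MeasurableEquiv.piUnique (fun _ : Finset.Iic 0 => S × A)).symm) := rfl
  rw [h, ← Measure.map_map he (by fun_prop), h', Measure.map_comp _ _ (by fun_prop),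
    Kernel.traj_map_frestrictLe, Kernel.partialTraj_self, Measure.id_comp,
    Measure.map_map he (by fun_prop)]
  convert Measure.map_id
  exact (MeasurableEquiv.piUnique fun _ : Finset.Iic 0 => S × A).self_comp_symm

/-- The joint law of the history up to `n` and the next pair is a composition-product; its second
marginal only involves the last coordinate of the history, since the kernel reads nothing else. -/
theorem pathLaw_map_succ (n : ℕ) : (pathLaw μ p π).map (fun x => x (n + 1)) =
    stateActionKernel p π ∘ₘ (pathLaw μ p π).map (fun x => x n) := by
  set κ : (n : ℕ) → Kernel (Π _ : Finset.Iic n, S × A) (S × A) := fun n =>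
    (stateActionKernel p π).comap
      (fun h : ((i : Finset.Iic n) → S × A) => h ⟨n, Finset.mem_Iic.2 le_rfl⟩)
      (measurable_pi_apply _)
  let e : (Π _ : Finset.Iic n, S × A) → S × A := fun h => h ⟨n, Finset.mem_Iic.2 le_rfl⟩
  have he : Measurable e := measurable_pi_apply _
  have h := Kernel.map_frestrictLe_trajMeasure_compProd_eq_map_trajMeasure (X := fun _ => S × A)
    (μ₀ := μ ⊗ₘ π) (κ := κ) (a := n)
  have h' : pathLaw μ p π = Kernel.trajMeasure (X := fun _ => S × A) (μ ⊗ₘ π) κ := rfl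
  rw [← h'] at h
  have h₂ := congrArg (Measure.map Prod.snd) h
  have : IsProbabilityMeasure ((pathLaw μ p π).map
      (Preorder.frestrictLe (π := fun _ => S × A) n)) :=
    Measure.isProbabilityMeasure_map (by fun_prop)
  have h₃ : (fun x : ℕ → S × A => x n) =
      e ∘ Preorder.frestrictLe (π := fun _ => S × A) n := rfl
  rw [Measure.map_map measurable_snd (by fun_prop)] at h₂
  change _ = (pathLaw μ p π).map (fun x => x (n + 1)) at h₂
  rw [← h₂, ← Measure.snd, Measure.snd_compProd, h₃, ← Measure.map_map he (by fun_prop)]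
  ext B hB
  rw [Measure.bind_apply hB (Kernel.aemeasurable _), Measure.bind_apply hB (Kernel.aemeasurable _),
    lintegral_map (Kernel.measurable_coe _ hB) he]
  rfl

/-- Every action is drawn afresh from `π` at the current state, so regrouping the kernel
compositions turns a state-action step into a step of `stateKernel` followed by `π`. -/
theorem pathLaw_map_eval (n : ℕ) :
    (pathLaw μ p π).map (fun x => x n) = stateLaw μ p π n ⊗ₘ π := by
  induction n with
  | zero => exact pathLaw_map_zero μ p π
  | succ n ih =>
    rw [pathLaw_map_succ, ih, Measure.compProd_eq_comp_prod, Measure.compProd_eq_comp_prod,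
      stateLaw, stateActionKernel, stateKernel]
    simp only [Measure.comp_assoc, Kernel.comp_assoc]

/-- The expected return is a sum of integrals over the state laws. -/
theorem expectedReturn_eq_sum (r : ℕ → S × A → ℝ) (hr : ∀ h, Measurable (r h))
    (hr01 : ∀ h x, r h x ∈ Set.Icc (0 : ℝ) 1) (H : ℕ) :
    expectedReturn μ p π r H =
      ∑ h ∈ Finset.range H, ∫ s, ∫ a, r h (s, a) ∂(π s) ∂(stateLaw μ p π h) := by
  have hint : ∀ {Y : Type _} [MeasurableSpace Y] (ρ : Measure Y) [IsProbabilityMeasure ρ] (h : ℕ)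
      {g : Y → S × A}, Measurable g → Integrable (fun y => r h (g y)) ρ := by
    intro Y _ ρ _ h g hg
    refine Integrable.of_bound ((hr h).comp hg).aestronglyMeasurable 1 (ae_of_all _ fun y => ?_)
    rw [Real.norm_eq_abs, abs_of_nonneg (hr01 _ _).1]
    exact (hr01 _ _).2
  unfold expectedReturn
  rw [integral_finsetSum _ fun h _ => hint _ h (measurable_pi_apply h)]
  refine Finset.sum_congr rfl fun h _ => ?_
  rw [← integral_map (φ := fun x : ℕ → S × A => x h) (f := r h)
    (measurable_pi_apply h).aemeasurable (hr h).aestronglyMeasurable, pathLaw_map_eval,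
    Measure.integral_compProd]
  rw [← pathLaw_map_eval]
  have : IsProbabilityMeasure ((pathLaw μ p π).map fun x => x h) :=
    Measure.isProbabilityMeasure_map (measurable_pi_apply h).aemeasurable
  exact hint _ h measurable_id

theorem expectedReturn_mem_Icc (r : ℕ → S × A → ℝ) (hr01 : ∀ h x, r h x ∈ Set.Icc (0 : ℝ) 1)
    (H : ℕ) : expectedReturn μ p π r H ∈ Set.Icc (0 : ℝ) H := by
  unfold expectedReturn
  have h₀ : ∀ x : ℕ → S × A, 0 ≤ ∑ h ∈ Finset.range H, r h (x h) := fun x =>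
    Finset.sum_nonneg fun h _ => (hr01 _ _).1
  refine ⟨integral_nonneg h₀, ?_⟩
  calc _ ≤ ∫ _, (H : ℝ) ∂(pathLaw μ p π) := by
        refine integral_mono_of_nonneg (ae_of_all _ h₀) (integrable_const _) (ae_of_all _ fun x => ?_)
        exact (Finset.sum_le_sum fun h _ => (hr01 h (x h)).2).trans (by simp)
    _ = H := by simp

end Path

/-! ### Block structure -/

section Blocks

variable {ns na : ℕ} {C : Fin ns → Set S} {E : Fin na → Set A}

theorem IsBlockReward.measurable (hC : IsMeasPartition C) (hE : IsMeasPartition E)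
    {r : ℕ → S × A → ℝ} (hr : IsBlockReward C E r) (h : ℕ) : Measurable (r h) := by
  classical
  -- Measurability comes from factoring through the finite set of label pairs; the default `0` is
  -- used only for empty product blocks, which no point reaches.
  let R : Fin ns × Fin na → ℝ := fun ij =>
    if hne : ∃ x : S × A, x.1 ∈ C ij.1 ∧ x.2 ∈ E ij.2 then r h hne.choose else 0
  have hR : r h = fun x => R (hC.label x.1, hE.label x.2) := by
    ext x
    have hne : ∃ y : S × A, y.1 ∈ C (hC.label x.1) ∧ y.2 ∈ E (hE.label x.2) :=
      ⟨x, hC.mem_label _, hE.mem_label _⟩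
    simp only [R, dif_pos hne]
    exact hr.block h _ _ _ (hC.mem_label _) _ hne.choose_spec.1 _ (hE.mem_label _) _
      hne.choose_spec.2
  rw [hR]
  exact (measurable_of_finite R).comp
    ((hC.measurable_label.comp measurable_fst).prodMk (hE.measurable_label.comp measurable_snd))

theorem IsBlockReward.integral_eq_of_mem (hE : IsMeasPartition E)
    {r : ℕ → S × A → ℝ} (hr : IsBlockReward C E r) {π : Kernel S A} (hπ : IsBlockPolicy C π)
    (h : ℕ) {i : Fin ns} {s s' : S} (hs : s ∈ C i) (hs' : s' ∈ C i) :
    ∫ a, r h (s, a) ∂(π s) = ∫ a, r h (s', a) ∂(π s') := by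
  rw [hπ i s hs s' hs']
  congr 1 with a
  exact hr.block h i _ s hs s' hs' a (hE.mem_label a) a (hE.mem_label a)

theorem stateKernel_apply (p : Kernel (S × A) S) (π : Kernel S A) [IsSFiniteKernel π] (s : S)
    {B : Set S} (hB : MeasurableSet B) : stateKernel p π s B = ∫⁻ a, p (s, a) B ∂(π s) := by
  rw [stateKernel, Kernel.comp_apply' _ _ _ hB, Kernel.prod_apply, Kernel.id_apply,
    Measure.dirac_prod, lintegral_map (Kernel.measurable_coe p hB) (by fun_prop)]

theorem IsBlockTransition.apply_eq_of_mem (hC : IsMeasPartition C) {vS : Measure S}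
    {p : Kernel (S × A) S} (hp : IsBlockTransition vS C E p) {i : Fin ns} {s s' : S}
    (hs : s ∈ C i) (hs' : s' ∈ C i) (a : A) : p (s, a) = p (s', a) := by
  obtain ⟨q, -, -, hq⟩ := hp
  have h : ∀ j, (C j).indicator (1 : S → ℝ≥0∞) s = (C j).indicator 1 s' := by
    intro j
    have : s ∈ C j ↔ s' ∈ C j := ⟨fun h => hC.eq_of_mem hs h ▸ hs', fun h => hC.eq_of_mem hs' h ▸ hs⟩
    by_cases hj : s ∈ C j
    · simp [hj, this.1 hj]
    · simp [hj, mt this.2 hj]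
  simp only [hq, h]

theorem IsBlockTransition.stateKernel_eq_of_mem (hC : IsMeasPartition C) {vS : Measure S}
    {p : Kernel (S × A) S} (hp : IsBlockTransition vS C E p) {π : Kernel S A} [IsSFiniteKernel π]
    (hπ : IsBlockPolicy C π) {i : Fin ns} {s s' : S} (hs : s ∈ C i) (hs' : s' ∈ C i) :
    stateKernel p π s = stateKernel p π s' := by
  ext B hB
  simp only [stateKernel_apply _ _ _ hB, hp.apply_eq_of_mem hC hs hs', hπ i s hs s' hs']

/-- Relabelling the state clusters does not change the set of transition models. -/
theorem IsClusterTransition.of_perm {ξ : Measure S} (σ : Equiv.Perm (Fin ns))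
    {p : Kernel (S × A) S} (hp : IsClusterTransition ξ (fun i => C (σ i)) E p) :
    IsClusterTransition ξ C E p := by
  obtain ⟨q, hq1, hq⟩ := hp
  refine ⟨fun i j k => q (σ.symm i) j (σ.symm k), fun i j => ?_, fun s a => ?_⟩
  · rw [Equiv.sum_comp σ.symm fun k => q (σ.symm i) j k, hq1]
  · rw [hq]
    congr 1 with s'
    rw [← Equiv.sum_comp σ.symm]
    refine Finset.sum_congr rfl fun i _ => Finset.sum_congr rfl fun j _ => ?_
    rw [← Equiv.sum_comp σ.symm]
    simp only [Equiv.apply_symm_apply]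

/-- A stochastic matrix that avoids null clusters defines a transition model on the clusters which
does not depend on the action. -/
theorem exists_isClusterTransition (ξ : Measure S) [IsFiniteMeasure ξ] (hC : IsMeasPartition C)
    (hE : IsMeasPartition E) (Q : Fin ns → Fin ns → ℝ≥0) (hQ : ∀ i, ∑ k, Q i k = 1)
    (hQ0 : ∀ i k, ξ (C k) = 0 → Q i k = 0) :
    ∃ p : Kernel (S × A) S, IsMarkovKernel p ∧ IsClusterTransition ξ C E p ∧
      ∀ i, ∀ s ∈ C i, ∀ a, p (s, a) = ∑ k, Q i k • ξ[|C k] := by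
  classical
  let ν : Fin ns → Measure S := fun i => ∑ k, Q i k • ξ[|C k]
  let κ : Kernel (Fin ns) S := ⟨ν, measurable_of_finite ν⟩
  let p : Kernel (S × A) S := κ.comap (fun x => hC.label x.1) (hC.measurable_label.comp measurable_fst)
  have hp : ∀ i, ∀ s ∈ C i, ∀ a, p (s, a) = ν i := fun i s hs a => by
    change ν (hC.label s) = ν i
    rw [hC.label_eq_iff.2 hs]
  refine ⟨p, ⟨fun x => ⟨?_⟩⟩, ⟨fun i _ k => Q i k, fun i _ => hQ i, fun s a => ?_⟩, hp⟩
  · rw [hp _ x.1 (hC.mem_label _) x.2]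
    simp only [ν, Measure.coe_finsetSum, Finset.sum_apply, Measure.smul_apply]
    rw [← ENNReal.coe_one, ← hQ (hC.label x.1), ENNReal.ofNNReal_finsetSum]
    refine Finset.sum_congr rfl fun k _ => ?_
    -- Conditioning on a null set gives the zero measure, so total mass one requires zero weight
    -- there.
    by_cases hk : ξ (C k) = 0
    · simp [hQ0 _ k hk]
    · have := cond_isProbabilityMeasure hk
      simp [ENNReal.smul_def]
  · rw [hp _ s (hC.mem_label _) a]
    have hs : ∀ i, (C i).indicator (1 : S → ℝ≥0∞) s = if i = hC.label s then 1 else 0 := by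
      intro i
      by_cases h : i = hC.label s
      · rw [if_pos h, h, Set.indicator_of_mem (hC.mem_label s)]; rfl
      · rw [if_neg h, Set.indicator_of_notMem]
        exact fun h' => h (hC.label_eq_iff.2 h').symm
    have ha : ∀ j, (E j).indicator (1 : A → ℝ≥0∞) a = if j = hE.label a then 1 else 0 := by
      intro j
      by_cases h : j = hE.label a
      · rw [if_pos h, h, Set.indicator_of_mem (hE.mem_label a)]; rfl
      · rw [if_neg h, Set.indicator_of_notMem]
        exact fun h' => h (hE.label_eq_iff.2 h').symm
    have hdens : (fun s' => ∑ i, ∑ j, ∑ k, (Q i k : ℝ≥0∞) / ξ (C k) *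
        (C i).indicator 1 s * (E j).indicator 1 a * (C k).indicator 1 s') =
        ∑ k, ((Q (hC.label s) k : ℝ≥0∞) / ξ (C k)) • (C k).indicator (1 : S → ℝ≥0∞) := by
      ext s'
      simp only [hs, ha, Finset.sum_apply, Pi.smul_apply, smul_eq_mul]
      rw [Finset.sum_eq_single (hC.label s), Finset.sum_eq_single (hE.label a)]
      · simp
      · intro j _ hj; simp [hj]
      · simp
      · intro i _ hi; simp [hi]
      · simp
    rw [hdens]
    ext B hB
    rw [withDensity_apply _ hB]
    simp only [Finset.sum_apply, Pi.smul_apply, smul_eq_mul]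
    rw [lintegral_finsetSum _ fun k _ => (measurable_one.indicator (hC.measurable k)).const_mul _]
    simp only [ν, Measure.coe_finsetSum, Finset.sum_apply, Measure.smul_apply]
    refine Finset.sum_congr rfl fun k _ => ?_
    rw [lintegral_const_mul _ (measurable_one.indicator (hC.measurable k)),
      lintegral_indicator_one (hC.measurable k), Measure.restrict_apply (hC.measurable k),
      cond_apply (hC.measurable k), ENNReal.smul_def, smul_eq_mul, div_eq_mul_inv, mul_assoc]

end Blocks

variable {ns na : ℕ}

/-! ### Mismatch between blocks and clusters -/

section Mismatch

variable {C D : Fin ns → Set S} {ξ : Measure S}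

/-- On `C i` the measure `μ` is a multiple of `ξ`, so the fraction of `C i` outside `D i` is the
same for `ξ` and, when `μ` charges `C i`, for `μ`; then `μ (C i) ≤ 1`. -/
theorem IsBlockInitial.sum_measureReal_diff_le (hC : IsMeasPartition C) (hD : IsMeasPartition D)
    (hpos : ∀ i, 0 < ξ.real (C i)) {μ : Measure S} [IsProbabilityMeasure μ]
    (hμ : IsBlockInitial ξ C μ) :
    ∑ i, μ.real (C i \ D i) ≤ ∑ i, ξ.real (C i \ D i) / ξ.real (C i) := by
  obtain ⟨w, hw⟩ := hμ
  have hμB : ∀ i, ∀ B ⊆ C i, MeasurableSet B → μ.real B = w i * ξ.real B := by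
    intro i B hB hBm
    have : μ B = w i * ξ B := by
      rw [hw, withDensity_apply _ hBm, setLIntegral_congr_fun (g := fun _ => (w i : ℝ≥0∞)) hBm,
        setLIntegral_const]
      intro s hs
      dsimp only
      rw [Finset.sum_eq_single i, Set.indicator_of_mem (hB hs), Pi.one_apply, mul_one]
      · intro j _ hj
        rw [Set.indicator_of_notMem, mul_zero]
        exact fun h => hj (hC.eq_of_mem h (hB hs))
      · simp
    simp [measureReal_def, this]
  refine Finset.sum_le_sum fun i _ => ?_
  have h₁ := hμB i _ Set.sdiff_subset ((hC.measurable i).diff (hD.measurable i))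
  have h₂ := hμB i _ subset_rfl (hC.measurable i)
  have h₃ : μ.real (C i) ≤ 1 := measureReal_le_one
  rw [h₁, le_div_iff₀ (hpos i)]
  calc _ = μ.real (C i) * ξ.real (C i \ D i) := by rw [h₂]; ring
    _ ≤ 1 * ξ.real (C i \ D i) := mul_le_mul_of_nonneg_right h₃ measureReal_nonneg
    _ = _ := one_mul _

theorem measureReal_block_le_two_mul_cluster [IsProbabilityMeasure ξ] (hD : IsMeasPartition D)
    (hpos : ∀ i, 0 < ξ.real (C i)) {ε : ℝ}
    (hε : ∑ i, ξ.real (C i \ D i) / ξ.real (C i) ≤ ε) (hε2 : ε ≤ 1 / 2) (k : Fin ns) :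
    ξ.real (C k) ≤ 2 * ξ.real (D k) := by
  have h₁ : ξ.real (C k \ D k) / ξ.real (C k) ≤ 1 / 2 :=
    (Finset.single_le_sum (f := fun i => ξ.real (C i \ D i) / ξ.real (C i))
      (fun i _ => div_nonneg measureReal_nonneg measureReal_nonneg)
      (Finset.mem_univ k)).trans (hε.trans hε2)
  rw [div_le_iff₀ (hpos k)] at h₁
  have h₂ := measureReal_inter_add_sdiff (μ := ξ) (s := C k) (hD.measurable k)
  have h₃ : ξ.real (C k ∩ D k) ≤ ξ.real (D k) := measureReal_mono Set.inter_subset_right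
  linarith

/-- A point of `D k \ C k` lies in some `C i` with `i ≠ k`, hence outside `D i`: it is
misclassified. Comparing `ξ (C i)` with `ξ (C k)` costs `K`, and normalizing by `ξ (D k) ≥ ξ (C k) /
2` costs the factor `2`. -/
theorem one_sub_cond_cluster_block_le [IsProbabilityMeasure ξ] (hC : IsMeasPartition C)
    (hD : IsMeasPartition D) (hpos : ∀ i, 0 < ξ.real (C i)) {K ε : ℝ} (hK : ∀ i j, ξ.real (C i) ≤ K * ξ.real (C j))
    (hε : ∑ i, ξ.real (C i \ D i) / ξ.real (C i) ≤ ε) (hε2 : ε ≤ 1 / 2) (k : Fin ns) :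
    1 - (ξ[|D k]).real (C k) ≤ 2 * K * ε := by
  have h₁ := measureReal_block_le_two_mul_cluster hD hpos hε hε2 k
  have hDk : 0 < ξ.real (D k) := by linarith [hpos k]
  have hK0 : 0 ≤ K := nonneg_of_mul_nonneg_left ((hpos k).le.trans (hK k k)) (hpos k)
  have h₂ : ξ.real (D k \ C k) ≤ K * ξ.real (C k) * ε := by
    calc ξ.real (D k \ C k) = ∑ i, ξ.real ((D k \ C k) ∩ C i) :=
          (hC.sum_measureReal_inter ξ _).symm
      _ ≤ ∑ i, ξ.real (C i \ D i) := Finset.sum_le_sum fun i _ => by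
          refine measureReal_mono fun s hs => ⟨hs.2, fun h => hs.1.2 ?_⟩
          rw [hD.eq_of_mem hs.1.1 h]
          exact hs.2
      _ ≤ ∑ i, K * ξ.real (C k) * (ξ.real (C i \ D i) / ξ.real (C i)) :=
          Finset.sum_le_sum fun i _ => by
            rw [mul_div_assoc', le_div_iff₀ (hpos i), mul_comm]
            exact mul_le_mul_of_nonneg_right (hK i k) measureReal_nonneg
      _ ≤ _ := by
          rw [← Finset.mul_sum]
          exact mul_le_mul_of_nonneg_left hε (mul_nonneg hK0 (hpos k).le)
  have hε0 : 0 ≤ ε := le_trans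
    (Finset.sum_nonneg fun i _ => div_nonneg measureReal_nonneg measureReal_nonneg) hε
  have h₃ : (ξ[|D k]).real (C k) = ξ.real (D k ∩ C k) / ξ.real (D k) := by
    rw [measureReal_def, cond_apply (hD.measurable k), ENNReal.toReal_mul, ENNReal.toReal_inv,
      measureReal_def, measureReal_def, div_eq_inv_mul]
  have h₄ := measureReal_inter_add_sdiff (μ := ξ) (s := D k) (hC.measurable k)
  rw [h₃, one_sub_div hDk.ne', div_le_iff₀ hDk]
  calc ξ.real (D k) - ξ.real (D k ∩ C k) = ξ.real (D k \ C k) := by linarith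
    _ ≤ K * ξ.real (C k) * ε := h₂
    _ ≤ K * (2 * ξ.real (D k)) * ε := by gcongr
    _ = _ := by ring

end Mismatch

/-! ### The best-fit transition model -/

/-- If clusters and blocks are labelled consistently and nearly agree, then the transition model on
the clusters that copies the block transition probabilities under the policy has a return close to
the true one. -/
theorem exists_isClusterTransition_expectedReturn_le {C D : Fin ns → Set S} {E E' : Fin na → Set A}
    {vS ξ : Measure S} [IsProbabilityMeasure ξ] (hC : IsMeasPartition C) (hD : IsMeasPartition D)
    (hE : IsMeasPartition E) (hE' : IsMeasPartition E') (hpos : ∀ i, 0 < ξ.real (C i)) {K ε : ℝ}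
    (hK : ∀ i j, ξ.real (C i) ≤ K * ξ.real (C j))
    (hε : ∑ i, ξ.real (C i \ D i) / ξ.real (C i) ≤ ε) (hε2 : ε ≤ 1 / 2)
    (μ : Measure S) [IsProbabilityMeasure μ] (hμ : IsBlockInitial ξ C μ)
    (p : Kernel (S × A) S) [IsMarkovKernel p] (hp : IsBlockTransition vS C E p)
    (r : ℕ → S × A → ℝ) (hr : IsBlockReward C E r)
    (π : Kernel S A) [IsMarkovKernel π] (hπ : IsBlockPolicy C π) (H : ℕ) :
    ∃ (p' : Kernel (S × A) S) (_ : IsMarkovKernel p'), IsClusterTransition ξ D E' p' ∧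
      |expectedReturn μ p π r H - expectedReturn μ p' π r H| ≤ 3 * K * ε * H := by
  have hCne : ∀ i, ∃ s, s ∈ C i := fun i => by
    rw [← Set.Nonempty, Set.nonempty_iff_ne_empty]
    intro h
    simpa [h] using hpos i
  choose rep hrep using hCne
  have hDpos : ∀ k, 0 < ξ.real (D k) := fun k => by
    linarith [hpos k, measureReal_block_le_two_mul_cluster hD hpos hε hε2 k]
  have hDne : ∀ k, ξ (D k) ≠ 0 := fun k h => by simpa [measureReal_def, h] using hDpos k
  have hcond : ∀ k, IsProbabilityMeasure (ξ[|D k]) := fun k =>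
    cond_isProbabilityMeasure (hDne k)
  let T : Fin ns → Fin ns → ℝ := fun i k => (stateKernel p π (rep i)).real (C k)
  have hT0 : ∀ i k, 0 ≤ T i k := fun i k => measureReal_nonneg
  have hT1 : ∀ i, ∑ k, T i k = 1 := fun i => hC.sum_measureReal _
  obtain ⟨p', hp'M, hp'C, hp'⟩ := exists_isClusterTransition ξ hD hE'
    (fun i k => (T i k).toNNReal)
    (fun i => by rw [← Real.toNNReal_sum_of_nonneg fun k _ => hT0 i k, hT1, Real.toNNReal_one])
    (fun i k h => absurd h (hDne k))
  -- `p'` ignores the action, so averaging over `π` changes nothing, even though `π` need not be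
  -- constant on `D i`.
  have hsk : ∀ i, ∀ s ∈ D i, ∀ B, MeasurableSet B →
      (stateKernel p' π s).real B = ∑ k, T i k * (ξ[|D k]).real B := by
    intro i s hs B hB
    have h : stateKernel p' π s B = (∑ k, (T i k).toNNReal • ξ[|D k]) B := by
      rw [stateKernel_apply _ _ _ hB]
      simp only [hp' i s hs, lintegral_const, measure_univ, mul_one]
    rw [measureReal_def, h]
    simp only [Measure.coe_finsetSum, Finset.sum_apply, Measure.smul_apply, ENNReal.smul_def,
      smul_eq_mul]
    rw [ENNReal.toReal_sum fun k _ => ENNReal.mul_ne_top ENNReal.coe_ne_top (measure_ne_top _ _)]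
    exact Finset.sum_congr rfl fun k _ => by
      rw [ENNReal.toReal_mul, ENNReal.coe_toReal, Real.coe_toNNReal _ (hT0 i k), measureReal_def]
  have hDrep : ∀ i, ∃ s, s ∈ D i := fun i => nonempty_of_measure_ne_zero (hDne i)
  choose rep' hrep' using hDrep
  have hsk' : ∀ i, ∀ s ∈ D i, stateKernel p' π s = stateKernel p' π (rep' i) := by
    intro i s hs
    ext B hB
    have h := (hsk i s hs B hB).trans (hsk i _ (hrep' i) B hB).symm
    exact (measureReal_eq_measureReal_iff).1 h
  let a : ℕ → Fin ns → ℝ := fun n i => (stateLaw μ p π n).real (C i)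
  let b : ℕ → Fin ns → ℝ := fun n i => (stateLaw μ p' π n).real (D i)
  let b' : ℕ → Fin ns → ℝ := fun n i => (stateLaw μ p' π n).real (C i)
  have ha : ∀ n j, a (n + 1) j = ∑ i, a n i * T i j := fun n j =>
    hC.comp_apply_of_eqOn _ (stateKernel p π) (fun i => stateKernel p π (rep i))
      (fun i s hs => hp.stateKernel_eq_of_mem hC hπ hs (hrep i)) (hC.measurable j)
  have hstep : ∀ n B, MeasurableSet B → (stateLaw μ p' π (n + 1)).real B =
      ∑ k, (∑ i, b n i * T i k) * (ξ[|D k]).real B := by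
    intro n B hB
    rw [stateLaw, hD.comp_apply_of_eqOn _ _ (fun i => stateKernel p' π (rep' i)) hsk' hB]
    simp only [hsk _ _ (hrep' _) B hB, Finset.sum_mul, Finset.mul_sum]
    rw [Finset.sum_comm]
    simp only [mul_assoc, b]
  have hb : ∀ n j, b (n + 1) j = ∑ i, b n i * T i j := by
    intro n j
    refine (hstep n _ (hD.measurable j)).trans ?_
    rw [Finset.sum_eq_single j]
    · rw [measureReal_def (ξ[|D j]), cond_apply_self (hDne j) (measure_ne_top _ _)]
      simp
    · intro k _ hk
      rw [measureReal_def, cond_apply (hD.measurable k), (hD.disjoint hk).inter_eq]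
      simp
    · simp
  -- Only from time one on is the state law a mixture of the `ξ[|D k]`; at time zero it is `μ`, the
  -- same for both models, so the block masses agree exactly.
  have hb' : ∀ n i, b' (n + 1) i = ∑ k, b (n + 1) k * (ξ[|D k]).real (C i) := by
    intro n i
    simp only [hb]
    exact hstep n _ (hC.measurable i)
  have hε0 : 0 ≤ ε := le_trans
    (Finset.sum_nonneg fun i _ => div_nonneg measureReal_nonneg measureReal_nonneg) hε
  obtain ⟨i₀⟩ : Nonempty (Fin ns) := by
    by_contra h
    rw [not_nonempty_iff] at h
    simpa using hC.sum_measureReal ξ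
  have hK1 : 1 ≤ K := le_of_mul_le_mul_right (by simpa using hK i₀ i₀) (hpos i₀)
  have hclose : ∀ n, ∑ i, |a n i - b' n i| ≤ 2 * ε + 2 * (2 * K * ε) := by
    intro n
    cases n with
    | zero =>
      have h : a 0 = b' 0 := rfl
      simp only [h, sub_self, abs_zero, Finset.sum_const_zero]
      positivity
    | succ n =>
      have h₁ := (sum_abs_sub_le_of_step T hT0 hT1 a b ha hb (n + 1)).trans
        (hC.sum_abs_measureReal_sub_le hD μ)
      have h₂ := (hμ.sum_measureReal_diff_le hC hD hpos).trans hε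
      have h₃ := sum_abs_sub_vecMul_le (fun k i => (ξ[|D k]).real (C i))
        (fun _ _ => measureReal_nonneg) (fun k => hC.sum_measureReal _)
        (one_sub_cond_cluster_block_le hC hD hpos hK hε hε2) (b (n + 1))
        (fun _ => measureReal_nonneg) (hD.sum_measureReal _)
      simp only [← hb'] at h₃
      calc ∑ i, |a (n + 1) i - b' (n + 1) i|
          ≤ ∑ i, (|a (n + 1) i - b (n + 1) i| + |b (n + 1) i - b' (n + 1) i|) :=
            Finset.sum_le_sum fun i _ => abs_sub_le _ _ _
        _ ≤ _ := by rw [Finset.sum_add_distrib]; linarith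
  let ρ : ℕ → Fin ns → ℝ := fun h i => ∫ x, r h (rep i, x) ∂(π (rep i))
  have hρ01 : ∀ h i, ρ h i ∈ Set.Icc (0 : ℝ) 1 := by
    intro h i
    refine ⟨integral_nonneg fun x => (hr.mem_Icc h _).1, ?_⟩
    calc ρ h i ≤ ∫ _, (1 : ℝ) ∂(π (rep i)) :=
          integral_mono_of_nonneg (ae_of_all _ fun x => (hr.mem_Icc h _).1) (integrable_const _)
            (ae_of_all _ fun x => (hr.mem_Icc h _).2)
      _ = 1 := by simp
  have hρ : ∀ h s, ∫ x, r h (s, x) ∂(π s) = ρ h (hC.label s) := fun h s =>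
    hr.integral_eq_of_mem hE hπ h (hC.mem_label s) (hrep _)
  have hrm := hr.measurable hC hE
  refine ⟨p', hp'M, hp'C, ?_⟩
  rw [expectedReturn_eq_sum μ p π r hrm hr.mem_Icc, expectedReturn_eq_sum μ p' π r hrm hr.mem_Icc,
    ← Finset.sum_sub_distrib]
  simp only [hρ, hC.integral_label]
  calc |∑ h ∈ Finset.range H, (∑ i, a h i * ρ h i - ∑ i, b' h i * ρ h i)|
      ≤ ∑ h ∈ Finset.range H, |∑ i, a h i * ρ h i - ∑ i, b' h i * ρ h i| :=
        Finset.abs_sum_le_sum_abs _ _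
    _ ≤ ∑ _h ∈ Finset.range H, 3 * K * ε := by
        refine Finset.sum_le_sum fun h _ => ?_
        have h₁ := abs_sum_mul_sub_le (a h) (b' h) (ρ h)
          ((hC.sum_measureReal _).trans (hC.sum_measureReal _).symm) (hρ01 h)
        have h₂ := hclose h
        have h₃ : ε ≤ K * ε := le_mul_of_one_le_left hε0 hK1
        linarith
    _ = 3 * K * ε * H := by simp; ring

/-! ### The error bound -/

/-- A misclassified state makes every pair containing it misclassified, whatever the action
labelling. Keeping one action block `j` suffices, and `η (E j)` cancels in the ratio. -/
theorem exists_perm_sum_le_misclassification {ξ : Measure S} [IsProbabilityMeasure ξ]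
    {η : Measure A} [IsProbabilityMeasure η] {C C' : Fin ns → Set S} {E E' : Fin na → Set A}
    (hE : IsMeasPartition E) (hpos : ∀ i j, (ξ.prod η) (C i ×ˢ E j) ≠ 0) :
    ∃ σ : Equiv.Perm (Fin ns), ∑ i, ξ (C i \ C' (σ i)) / ξ (C i) ≤
      misclassification ξ η C E C' E' := by
  obtain ⟨σ₁, h₁⟩ := exists_eq_ciInf_of_finite (f := fun σ₁ : Equiv.Perm (Fin ns) =>
    ⨅ σ₂ : Equiv.Perm (Fin na), ∑ i, ∑ j, (ξ.prod η) ((C i ×ˢ E j) \ (C' (σ₁ i) ×ˢ E' (σ₂ j))) /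
      (ξ.prod η) (C i ×ˢ E j))
  refine ⟨σ₁, ?_⟩
  rw [misclassification, ← h₁]
  refine le_iInf fun σ₂ => Finset.sum_le_sum fun i _ => ?_
  obtain ⟨j⟩ : Nonempty (Fin na) := by
    by_contra h
    rw [not_nonempty_iff] at h
    simpa using hE.sum_measureReal η
  refine le_trans ?_ (Finset.single_le_sum (f := fun j =>
    (ξ.prod η) ((C i ×ˢ E j) \ (C' (σ₁ i) ×ˢ E' (σ₂ j))) / (ξ.prod η) (C i ×ˢ E j))
    (fun _ _ => zero_le) (Finset.mem_univ j))
  have hη : η (E j) ≠ 0 := fun h => hpos i j (by rw [Measure.prod_prod, h, mul_zero])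
  calc ξ (C i \ C' (σ₁ i)) / ξ (C i)
      = (ξ.prod η) ((C i \ C' (σ₁ i)) ×ˢ E j) / (ξ.prod η) (C i ×ˢ E j) := by
        rw [Measure.prod_prod, Measure.prod_prod,
          ENNReal.mul_div_mul_right _ _ hη (measure_ne_top _ _)]
    _ ≤ _ := by
        refine ENNReal.div_le_div_right (measure_mono ?_) _
        rintro ⟨s, x⟩ ⟨hs, hx⟩
        exact ⟨⟨hs.1, hx⟩, fun h => hs.2 h.1⟩

theorem minMass_ne_zero {ξ : Measure S} {η : Measure A} {C : Fin ns → Set S} {E : Fin na → Set A}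
    (hpos : ∀ i j, (ξ.prod η) (C i ×ˢ E j) ≠ 0) : minMass ξ η C E ≠ 0 := by
  have h := (Finset.lt_inf_iff (s := Finset.univ) (f := fun x : Fin ns × Fin na =>
    (ξ.prod η) (C x.1 ×ˢ E x.2)) ENNReal.zero_lt_top).2 fun x _ => pos_iff_ne_zero.2 (hpos _ _)
  rw [Finset.inf_univ_eq_iInf, iInf_prod] at h
  exact h.ne'

theorem maxMass_le_one {ξ : Measure S} [IsProbabilityMeasure ξ] {η : Measure A}
    [IsProbabilityMeasure η] {C : Fin ns → Set S} {E : Fin na → Set A} : maxMass ξ η C E ≤ 1 :=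
  iSup₂_le fun _ _ => prob_le_one

/-- Pair both state blocks with the same action block and cancel its mass: the ratio of extreme
product masses also bounds ratios of state masses. -/
theorem measure_block_le_mul {ξ : Measure S} [IsProbabilityMeasure ξ] {η : Measure A}
    [IsProbabilityMeasure η] {C : Fin ns → Set S} {E : Fin na → Set A} (hE : IsMeasPartition E)
    (hpos : ∀ i j, (ξ.prod η) (C i ×ˢ E j) ≠ 0) (i k : Fin ns) :
    ξ (C i) ≤ maxMass ξ η C E / minMass ξ η C E * ξ (C k) := by
  obtain ⟨j⟩ : Nonempty (Fin na) := by
    by_contra h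
    rw [not_nonempty_iff] at h
    simpa using hE.sum_measureReal η
  have hη : η (E j) ≠ 0 := fun h => hpos i j (by rw [Measure.prod_prod, h, mul_zero])
  have hmax : ξ (C i) * η (E j) ≤ maxMass ξ η C E := by
    rw [← Measure.prod_prod]; exact le_iSup₂ (f := fun i j => (ξ.prod η) (C i ×ˢ E j)) i j
  have hmin : minMass ξ η C E ≤ ξ (C k) * η (E j) := by
    rw [← Measure.prod_prod]; exact iInf₂_le (f := fun i j => (ξ.prod η) (C i ×ˢ E j)) k j
  have hmin0 := minMass_ne_zero hpos
  have hmin_top : minMass ξ η C E ≠ ⊤ :=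
    ne_top_of_le_ne_top (ENNReal.mul_ne_top (measure_ne_top _ _) (measure_ne_top _ _)) hmin
  rw [← ENNReal.mul_le_mul_iff_left hη (measure_ne_top η (E j))]
  calc ξ (C i) * η (E j) ≤ maxMass ξ η C E := hmax
    _ = maxMass ξ η C E / minMass ξ η C E * minMass ξ η C E :=
        (ENNReal.div_mul_cancel hmin0 hmin_top).symm
    _ ≤ maxMass ξ η C E / minMass ξ η C E * (ξ (C k) * η (E j)) := by gcongr
    _ = _ := (mul_assoc _ _ _).symm

/-- The state abstraction error of arbitrary clusters is controlled by their misclassification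
error. -/
theorem abstractionError_le {vS ξ : Measure S} [IsProbabilityMeasure ξ]
    {η : Measure A} [IsProbabilityMeasure η] {C C' : Fin ns → Set S} {E E' : Fin na → Set A}
    (hC : IsMeasPartition C) (hE : IsMeasPartition E) (hC' : IsMeasPartition C')
    (hE' : IsMeasPartition E') (hpos : ∀ i j, (ξ.prod η) (C i ×ˢ E j) ≠ 0) (H : ℕ) :
    abstractionError vS ξ C E C' E' H ≤
      4 * (maxMass ξ η C E / minMass ξ η C E) * (H : ℝ≥0∞) ^ 2 *
        misclassification ξ η C E C' E' := by
  have hblock := measure_block_le_mul (ξ := ξ) hE hpos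
  set κ := maxMass ξ η C E / minMass ξ η C E
  set M := misclassification ξ η C E C' E'
  have hκtop : κ ≠ ⊤ := ENNReal.div_ne_top
    (ne_top_of_le_ne_top ENNReal.one_ne_top maxMass_le_one) (minMass_ne_zero hpos)
  obtain ⟨j₀⟩ : Nonempty (Fin na) := by
    by_contra h
    rw [not_nonempty_iff] at h
    simpa using hE.sum_measureReal η
  have hξ0 : ∀ i, ξ (C i) ≠ 0 := fun i h => hpos i j₀ (by rw [Measure.prod_prod, h, zero_mul])
  have hξpos : ∀ i, 0 < ξ.real (C i) := fun i =>
    ENNReal.toReal_pos (hξ0 i) (measure_ne_top _ _)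
  obtain ⟨i₀, hi₀⟩ : ∃ i, ξ (C' i) ≠ 0 := by
    by_contra! h
    simpa [measureReal_def, h] using hC'.sum_measureReal ξ
  have hκ1 : 1 ≤ κ := by
    have h := hblock i₀ i₀
    rw [← ENNReal.mul_le_mul_iff_left (hξ0 i₀) (measure_ne_top _ _), one_mul]
    exact h
  unfold abstractionError
  refine iSup_le fun μ => iSup_le fun _ => iSup_le fun hμ => iSup_le fun p => iSup_le fun _ =>
    iSup_le fun hp => iSup_le fun r => iSup_le fun hr => iSup_le fun π => iSup_le fun _ =>
    iSup_le fun hπ => ?_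
  have hH : (H : ℝ≥0∞) ≤ (H : ℝ≥0∞) ^ 2 := by
    exact_mod_cast Nat.le_self_pow two_ne_zero H
  rcases le_or_gt M (1 / 2) with hM2 | hM2
  · obtain ⟨σ, hσ⟩ := exists_perm_sum_le_misclassification (C' := C') (E' := E') hE hpos
    have hMtop : M ≠ ⊤ := ne_top_of_le_ne_top (by simp) hM2
    have hε : ∑ i, ξ.real (C i \ C' (σ i)) / ξ.real (C i) ≤ M.toReal := by
      refine le_trans (le_of_eq ?_) (ENNReal.toReal_mono hMtop hσ)
      rw [ENNReal.toReal_sum fun i _ => ENNReal.div_ne_top (measure_ne_top _ _) (hξ0 i)]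
      simp only [ENNReal.toReal_div, measureReal_def]
    have hε2 : M.toReal ≤ 1 / 2 := by
      simpa using ENNReal.toReal_mono (by simp) hM2
    have hK : ∀ i j, ξ.real (C i) ≤ κ.toReal * ξ.real (C j) := fun i j => by
      rw [measureReal_def, measureReal_def, ← ENNReal.toReal_mul]
      exact ENNReal.toReal_mono (ENNReal.mul_ne_top hκtop (measure_ne_top _ _)) (hblock i j)
    obtain ⟨p', hp'M, hp'C, hp'⟩ := exists_isClusterTransition_expectedReturn_le hC
      (hC'.comp_equiv σ) hE hE' hξpos hK hε hε2 μ hμ p hp r hr π hπ H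
    refine (iInf_le_of_le p' <| iInf_le_of_le hp'M <| iInf_le _ (hp'C.of_perm σ)).trans ?_
    refine (ENNReal.ofReal_le_ofReal hp').trans ?_
    rw [ENNReal.ofReal_mul (by positivity), ENNReal.ofReal_mul (by positivity),
      ENNReal.ofReal_mul (by positivity), ENNReal.ofReal_toReal hκtop, ENNReal.ofReal_toReal hMtop,
      ENNReal.ofReal_natCast, mul_assoc _ M, mul_comm M, ← mul_assoc]
    gcongr
    simp
    norm_num
  -- Any model will do here; sending all mass to one non-null cluster is always admissible.
  · obtain ⟨p', hp'M, hp'C, -⟩ := exists_isClusterTransition ξ hC' hE'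
      (fun _ k => if k = i₀ then 1 else 0) (fun _ => by simp)
      (fun _ k hk => if_neg (by rintro rfl; exact hi₀ hk))
    refine (iInf_le_of_le p' <| iInf_le_of_le hp'M <| iInf_le _ hp'C).trans ?_
    have h₁ := expectedReturn_mem_Icc μ p π r hr.mem_Icc H
    have h₂ := expectedReturn_mem_Icc μ p' π r hr.mem_Icc H
    calc ENNReal.ofReal |expectedReturn μ p π r H - expectedReturn μ p' π r H|
        ≤ ENNReal.ofReal H := ENNReal.ofReal_le_ofReal <| by
          rw [abs_le]; constructor <;> linarith [h₁.1, h₁.2, h₂.1, h₂.2]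
      -- Split to compare factor by factor, using `2 ≤ 4`, `1 ≤ κ`, `H ≤ H ^ 2` and `1 / 2 < M`.
      _ = 2 * 1 * H * (1 / 2) := by
          rw [ENNReal.ofReal_natCast, mul_one, mul_comm 2, mul_assoc, one_div,
            ENNReal.mul_inv_cancel two_ne_zero ENNReal.ofNat_ne_top, mul_one]
      _ ≤ 4 * κ * H ^ 2 * M := by
          gcongr
          norm_num

end TensorMDP

theorem theorem5
    {S A : Type*} [MeasurableSpace S] [MeasurableSpace A]
    -- reference measures `ds`, `da`, the transition kernel and the behavior policy with its density
    (vS : Measure S) (vA : Measure A)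
    (p : Kernel (S × A) S) [IsMarkovKernel p]
    (πb : Kernel S A) [IsMarkovKernel πb]
    (πd : S → A → ℝ≥0) (_hπd : Measurable (Function.uncurry πd))
    (_hπb : ∀ s, πb s = vA.withDensity fun a => (πd s a : ℝ≥0∞))
    -- the stationary state distribution under the behavior policy
    (ξ : Measure S) [IsProbabilityMeasure ξ]
    (_hξ : Kernel.Invariant (TensorMDP.stateKernel p πb) ξ)
    -- the positive probability measure on actions
    (η : Measure A) [IsProbabilityMeasure η]
    (ηd : A → ℝ≥0) (_hηd : Measurable ηd) (_hηpos : ∀ a, 0 < ηd a)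
    (_hη : η = vA.withDensity fun a => (ηd a : ℝ≥0∞))
    -- the kernel spaces of functions of the state and of the action, with finite bases of features
    {HS HA : Type*} [NormedAddCommGroup HS] [InnerProductSpace ℝ HS] [RKHS ℝ HS S ℝ]
    [NormedAddCommGroup HA] [InnerProductSpace ℝ HA] [RKHS ℝ HA A ℝ]
    {dS dA : ℕ} (φ : Module.Basis (Fin dS) ℝ HS) (ψ : Module.Basis (Fin dA) ℝ HA)
    (_hHS : ∀ f : HS, Measurable fun s => f s) (_hHA : ∀ g : HA, Measurable fun a => g a)
    -- low Tucker rank of the transition operator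
    (r l m : ℕ) (_hrank : TensorMDP.OperatorTuckerRankLE HS HA p r l m)
    -- block structure
    {ns na : ℕ} (C : Fin ns → Set S) (E : Fin na → Set A)
    (_hC : TensorMDP.IsMeasPartition C) (_hE : TensorMDP.IsMeasPartition E)
    (_hblock : TensorMDP.IsBlockTransition vS C E p)
    (_hpos : ∀ i j, (ξ.prod η) (C i ×ˢ E j) ≠ 0)
    (δ : ℝ) (_hδ : δ ∈ Set.Ioo (0 : ℝ) 1) :
    ∃ N : ℕ, ∀ (ν : Measure S) [IsProbabilityMeasure ν] (n : ℕ), N ≤ n →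
      ∃ G : Set (ℕ → S × A), MeasurableSet G ∧
        ENNReal.ofReal (1 - δ) ≤ TensorMDP.pathLaw ν p πb G ∧
        ∀ x ∈ G, ∀ (C' : Fin ns → Set S) (E' : Fin na → Set A),
          TensorMDP.IsEstimatedClusters (fun s i => φ i s) (fun a j => ψ j a) ηd πd ξ η r l m n x
            C' E' →
          ∀ H : ℕ,
            TensorMDP.abstractionError vS ξ C E C' E' H ≤
              4 * (TensorMDP.maxMass ξ η C E / TensorMDP.minMass ξ η C E) * (H : ℝ≥0∞) ^ 2 *
                TensorMDP.misclassification ξ η C E C' E' := by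
  -- The bound is deterministic: it holds for every pair of partitions.
  refine ⟨0, fun ν _ n _ => ⟨Set.univ, MeasurableSet.univ, ?_, fun x _ C' E' hest H => ?_⟩⟩
  · rw [measure_univ]
    exact ENNReal.ofReal_le_one.2 (by linarith [_hδ.1])
  · obtain ⟨F, U₁, U₂, U₃, -, -, -, -, hclust⟩ := hest
    have hpart : TensorMDP.IsMeasPartition C' ∧ TensorMDP.IsMeasPartition E' :=
      hclust.elim (fun h => ⟨h.1.1, h.2.1⟩) fun h => ⟨h.1, h.2.1⟩
    exact TensorMDP.abstractionError_le _hC _hE hpart.1 hpart.2 _hpos H
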